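/- Let $X$ be a compact Hausdorff space, let $\mathcal F(X)$ be a $\sigma$-algebra on $X$ containing the Borel sets, and let $\mathcal H$ be a complex Hilbert space of finite dimension $d$. Let $\nu:\mathcal F(X)\to\mathcal B(\mathcal H)$ be a quantum probability measure, i.e. $\nu(E)\ge 0$ for every $E\in\mathcal F(X)$, $\nu$ is countably additive, and $\nu(X)=1\neq 0$. Assume that $\nu$ is regular on Borel sets: for every Borel set $E\subseteq X$, in the Loewner order, $$\nu(E)=\inf\{\nu(U): U\supseteq E \text{ open}\}=\sup\{\nu(K): K\subseteq E\text{ compact}\}$$ (this is automatic if $X$ is metrizable). Let $\mu=\frac1d\operatorname{tr}\circ\nu$ be the induced classical probability measure, and let $\frac{d\nu}{d\mu}:X\to\mathcal B(\mathcal H)$ be the principal Radon–Nikodým derivative, the ($\mu$-a.e. unique) measurable function with $\int_E\operatorname{tr}\big(\rho\,\tfrac{d\nu}{d\mu}\big)\,d\mu=\operatorname{tr}(\rho\,\nu(E))$ for every $E\in\mathcal F(X)$ and every density operator $\rho$ (it is positive $\mu$-a.e.). For $\psi\in L^\infty_{\mathcal H}(X,\nu):=L^\infty(X,\mu;\mathcal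 B(\mathcal H))$ define the quantum expectation $$\mathbb E_\nu(\psi)=\int_X\Big(\frac{d\nu}{d\mu}\Big)^{1/2}\psi\,\Big(\frac{d\nu}{d\mu}\Big)^{1/2}d\mu\in\mathcal B(\mathcal H)$$ and the quantum variance $$\operatorname{Var}_\nu(\psi)=\tfrac12\Big(\mathbb E_\nu(\psi^*\psi)-\mathbb E_\nu(\psi^*)\mathbb E_\nu(\psi)+\mathbb E_\nu(\psi\psi^*)-\mathbb E_\nu(\psi)\mathbb E_\nu(\psi^*)\Big).$$ Let $N(\nu)=\sup\{\|\operatorname{Var}_\nu(\psi)\| : \psi\in L^\infty_{\mathcal H}(X,\nu),\ \|\psi\|_\infty\le 1\}$ be the random quantum noise of $\nu$. Then $N(\nu)=0$ if and only if there is a point $x_0\in X$ with $\nu=\delta_{x_0}1$, that is, $\nu(E)=1$ if $x_0\in E$ and $\nu(E)=0$ if $x_0\notin E$, for every $E\in\mathcal F(X)$. -/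

import Mathlib

open MeasureTheory Set
open scoped ENNReal

namespace QuantumNoise

noncomputable section

/-- The canonical trace on `B(H)`, for a finite-dimensional Hilbert space `H`. -/
def tr {H : Type*} [NormedAddCommGroup H] [InnerProductSpace ℂ H] :
    (H →L[ℂ] H) →ₗ[ℂ] ℂ :=
  LinearMap.trace ℂ H ∘ₗ ContinuousLinearMap.coeLM ℂ

/-- A density operator: a positive operator of trace one. -/
def IsDensityOperator {H : Type*} [NormedAddCommGroup H] [InnerProductSpace ℂ H]
    (ρ : H →L[ℂ] H) : Prop :=
  0 ≤ ρ ∧ tr ρ = 1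

/-- A positive operator-valued measure with values in `B(H)`: a countably additive map from the
measurable sets to the positive operators (Loewner order), with `ν(X) ≠ 0`. For finite-dimensional
`H` countable additivity in norm and in the ultraweak topology are the same thing. -/
structure POVM (X : Type*) [MeasurableSpace X] (H : Type*) [NormedAddCommGroup H]
    [InnerProductSpace ℂ H] extends VectorMeasure X (H →L[ℂ] H) where
  nonneg' : ∀ E, MeasurableSet E → 0 ≤ toVectorMeasure E
  univ_ne_zero' : toVectorMeasure univ ≠ 0

/-- A quantum probability measure: a positive operator-valued measure with `ν(X) = 1`. -/
structure QuantumProbMeasure (X : Type*) [MeasurableSpace X] (H : Type*) [NormedAddCommGroup H]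
    [InnerProductSpace ℂ H] extends POVM X H where
  univ_eq_one' : toVectorMeasure univ = 1

/-- A function `ψ : X → B(H)` is measurable (a quantum random variable) if `ω ∘ ψ` is measurable
for each functional `ω = tr (T ·)` in the predual of `B(H)`. -/
def IsQuantumRandomVariable {X : Type*} [MeasurableSpace X] {H : Type*} [NormedAddCommGroup H]
    [InnerProductSpace ℂ H] (ψ : X → H →L[ℂ] H) : Prop :=
  ∀ T : H →L[ℂ] H, Measurable fun x => tr (T * ψ x)

/-- `ν` is regular on Borel sets: for every Borel set `E`, in the Loewner order, `ν(E)` is the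
infimum of `ν(U)` over the open `U ⊇ E` and the supremum of `ν(K)` over the compact `K ⊆ E`. -/
def QuantumProbMeasure.IsRegular {X : Type*} [TopologicalSpace X] [MeasurableSpace X]
    {H : Type*} [NormedAddCommGroup H] [InnerProductSpace ℂ H]
    (ν : QuantumProbMeasure X H) : Prop :=
  ∀ E : Set X, MeasurableSet[borel X] E →
    IsGLB {T | ∃ U : Set X, IsOpen U ∧ E ⊆ U ∧ ν.toVectorMeasure U = T} (ν.toVectorMeasure E) ∧
    IsLUB {T | ∃ K : Set X, IsCompact K ∧ K ⊆ E ∧ ν.toVectorMeasure K = T} (ν.toVectorMeasure E)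

theorem tr_re_nonneg {H : Type*} [NormedAddCommGroup H] [InnerProductSpace ℂ H]
    {T : H →L[ℂ] H} (hT : 0 ≤ T) : 0 ≤ (tr T).re := by
  have h := (ContinuousLinearMap.nonneg_iff_isPositive T).1 hT
  exact (Complex.le_def.1 (LinearMap.IsPositive.trace_nonneg h.toLinearMap)).1

/-- A positive operator of trace zero vanishes. -/
theorem eq_zero_of_tr_re_eq_zero {H : Type*} [NormedAddCommGroup H] [InnerProductSpace ℂ H]
    [FiniteDimensional ℂ H] {T : H →L[ℂ] H} (hT : 0 ≤ T) (h0 : (tr T).re = 0) : T = 0 := by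
  have h := ((ContinuousLinearMap.nonneg_iff_isPositive T).1 hT).toLinearMap
  have hp := (LinearMap.posSemidef_toMatrix_iff (stdOrthonormalBasis ℂ H)).2 h
  have him : (tr T).im = 0 := (Complex.le_def.1 (LinearMap.IsPositive.trace_nonneg h)).2.symm
  have ht : tr T = 0 := Complex.ext h0 him
  have hm := hp.trace_eq_zero_iff.1 (by
    rw [← LinearMap.trace_eq_matrix_trace ℂ (stdOrthonormalBasis ℂ H).toBasis]; exact ht)
  have hl : (T : H →ₗ[ℂ] H) = 0 := by simpa using hm
  exact ContinuousLinearMap.ext fun x => LinearMap.congr_fun hl x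

section Induced

variable {X : Type*} [MeasurableSpace X] {H : Type*} [NormedAddCommGroup H]
  [InnerProductSpace ℂ H] [FiniteDimensional ℂ H]

/-- The set function `E ↦ tr (ν(E)) / d`, `d = dim H`, as a signed measure. -/
def QuantumProbMeasure.normalizedTrace (ν : QuantumProbMeasure X H) : SignedMeasure X :=
  ν.toVectorMeasure.mapRange
    (((Module.finrank ℂ H : ℝ)⁻¹ • (Complex.reLm ∘ₗ (tr (H := H)).restrictScalars ℝ)).toAddMonoidHom)
    (LinearMap.continuous_of_finiteDimensional
      ((Module.finrank ℂ H : ℝ)⁻¹ • (Complex.reLm ∘ₗ (tr (H := H)).restrictScalars ℝ)))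

theorem QuantumProbMeasure.normalizedTrace_apply (ν : QuantumProbMeasure X H) (E : Set X) :
    ν.normalizedTrace E = (Module.finrank ℂ H : ℝ)⁻¹ * (tr (ν.toVectorMeasure E)).re := rfl

theorem QuantumProbMeasure.normalizedTrace_nonneg (ν : QuantumProbMeasure X H) :
    0 ≤[univ] ν.normalizedTrace := by
  refine VectorMeasure.restrict_le_restrict_of_subset_le _ _ fun E hE _ => ?_
  rw [ν.normalizedTrace_apply]
  exact mul_nonneg (by positivity) (tr_re_nonneg (ν.nonneg' E hE))

/-- The classical probability measure `μ = (1/d) tr ∘ ν` induced by `ν`. -/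
def QuantumProbMeasure.inducedMeasure (ν : QuantumProbMeasure X H) : Measure X :=
  ν.normalizedTrace.toMeasureOfZeroLE univ MeasurableSet.univ ν.normalizedTrace_nonneg

theorem QuantumProbMeasure.inducedMeasure_real_apply (ν : QuantumProbMeasure X H) {E : Set X}
    (hE : MeasurableSet E) :
    ν.inducedMeasure.real E = (Module.finrank ℂ H : ℝ)⁻¹ * (tr (ν.toVectorMeasure E)).re := by
  rw [inducedMeasure, SignedMeasure.toMeasureOfZeroLE_real_apply _ _ _ hE, univ_inter,
    normalizedTrace_apply]

instance QuantumProbMeasure.isFiniteMeasure_inducedMeasure (ν : QuantumProbMeasure X H) :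
    IsFiniteMeasure ν.inducedMeasure := by
  unfold inducedMeasure; infer_instance

/-- `D` is a principal Radon-Nikodym derivative `dν/dμ`: a quantum random variable with
`∫_E tr (ρ D) dμ = tr (ρ ν(E))` for all measurable `E` and all density operators `ρ`. -/
def QuantumProbMeasure.IsPrincipalRNDeriv (ν : QuantumProbMeasure X H)
    (D : X → H →L[ℂ] H) : Prop :=
  IsQuantumRandomVariable D ∧ ∀ ρ : H →L[ℂ] H, IsDensityOperator ρ →
    Integrable (fun x => tr (ρ * D x)) ν.inducedMeasure ∧
    ∀ E, MeasurableSet E →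
      ∫ x in E, tr (ρ * D x) ∂ν.inducedMeasure = tr (ρ * ν.toVectorMeasure E)

theorem QuantumProbMeasure.exists_isPrincipalRNDeriv (ν : QuantumProbMeasure X H) :
    ∃ D : X → H →L[ℂ] H, ν.IsPrincipalRNDeriv D := by
  classical
  let μ := ν.inducedMeasure
  let v := Module.finBasis ℝ (H →L[ℂ] H)
  let s : Fin (Module.finrank ℝ (H →L[ℂ] H)) → SignedMeasure X := fun k =>
    ν.toVectorMeasure.mapRange (v.coord k).toAddMonoidHom
      (LinearMap.continuous_of_finiteDimensional (v.coord k))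
  have hs : ∀ k E, s k E = v.repr (ν.toVectorMeasure E) k := fun k E => rfl
  have hd : Module.finrank ℂ H ≠ 0 := by
    intro h0
    have : Subsingleton H := Module.finrank_zero_iff.1 h0
    exact ν.univ_ne_zero' (ContinuousLinearMap.ext fun x => Subsingleton.elim _ _)
  have hac : ∀ k, s k ≪ᵥ μ.toENNRealVectorMeasure := by
    intro k
    refine VectorMeasure.AbsolutelyContinuous.mk fun E hE h0 => ?_
    rw [Measure.toENNRealVectorMeasure_apply_measurable hE] at h0
    have h1 := ν.inducedMeasure_real_apply hE
    have h2 : ν.inducedMeasure.real E = 0 := by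
      rw [Measure.real]; exact (ENNReal.toReal_eq_zero_iff _).2 (Or.inl h0)
    rw [h2] at h1
    have h3 : (tr (ν.toVectorMeasure E)).re = 0 := by
      rcases mul_eq_zero.1 h1.symm with h | h
      · exact absurd h (by simpa using hd)
      · exact h
    rw [hs, eq_zero_of_tr_re_eq_zero (ν.nonneg' E hE) h3]
    simp
  have hint : ∀ k, Integrable ((s k).rnDeriv μ) μ := fun k =>
    SignedMeasure.integrable_rnDeriv _ _
  have hset : ∀ k E, MeasurableSet E → ∫ x in E, (s k).rnDeriv μ x ∂μ = s k E := by
    intro k E hE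
    rw [← withDensityᵥ_apply (hint k) hE, SignedMeasure.withDensityᵥ_rnDeriv_eq _ _ (hac k)]
  have key : ∀ (T : H →L[ℂ] H) (x : X),
      tr (T * ∑ k, (s k).rnDeriv μ x • v k) = ∑ k, (s k).rnDeriv μ x • tr (T * v k) := by
    intro T x
    rw [Finset.mul_sum, map_sum]
    refine Finset.sum_congr rfl fun k _ => ?_
    rw [mul_smul_comm]
    exact ((tr (H := H)).restrictScalars ℝ).map_smul _ _
  refine ⟨fun x => ∑ k, (s k).rnDeriv μ x • v k, fun T => ?_, fun ρ _ => ⟨?_, fun E hE => ?_⟩⟩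
  · simp_rw [key]
    exact Finset.measurable_sum _ fun k _ =>
      (SignedMeasure.measurable_rnDeriv (s k) μ).smul_const _
  · simp_rw [key]
    exact integrable_finsetSum _ fun k _ => (hint k).smul_const _
  · simp_rw [key]
    rw [integral_finsetSum _ fun k _ => ((hint k).smul_const _).integrableOn]
    simp_rw [integral_smul_const]
    conv_rhs => rw [← v.sum_repr (ν.toVectorMeasure E), Finset.mul_sum, map_sum]
    refine Finset.sum_congr rfl fun k _ => ?_
    rw [hset k E hE, hs, mul_smul_comm]
    exact (((tr (H := H)).restrictScalars ℝ).map_smul _ _).symm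

/-- The principal Radon-Nikodym derivative `dν/dμ` (unique up to `μ`-null sets). -/
def QuantumProbMeasure.rnDeriv (ν : QuantumProbMeasure X H) : X → H →L[ℂ] H :=
  ν.exists_isPrincipalRNDeriv.choose

end Induced

section Noise

variable {X : Type*} [MeasurableSpace X] {H : Type*} [NormedAddCommGroup H]
  [InnerProductSpace ℂ H] [CompleteSpace H] [FiniteDimensional ℂ H]

/-- The quantum expectation `E_ν(ψ) = ∫ ψ dν`: the operator `∫ (dν/dμ)^{1/2} ψ (dν/dμ)^{1/2} dμ`. -/
def QuantumProbMeasure.expectation (ν : QuantumProbMeasure X H) (ψ : X → H →L[ℂ] H) :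
    H →L[ℂ] H :=
  ∫ x, CFC.sqrt (ν.rnDeriv x) * ψ x * CFC.sqrt (ν.rnDeriv x) ∂ν.inducedMeasure

/-- The integral is the operator characterised by `tr (ρ ∫ ψ dν) = ∫ ψ_ρ dμ` for density
operators `ρ` (in fact for all `ρ`). -/
theorem QuantumProbMeasure.tr_mul_expectation (ν : QuantumProbMeasure X H) {ψ : X → H →L[ℂ] H}
    (hψ : Integrable (fun x => CFC.sqrt (ν.rnDeriv x) * ψ x * CFC.sqrt (ν.rnDeriv x))
      ν.inducedMeasure) (ρ : H →L[ℂ] H) :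
    tr (ρ * ν.expectation ψ) =
      ∫ x, tr (ρ * (CFC.sqrt (ν.rnDeriv x) * ψ x * CFC.sqrt (ν.rnDeriv x)))
        ∂ν.inducedMeasure :=
  ((LinearMap.toContinuousLinearMap
    ((tr (H := H)) ∘ₗ LinearMap.mulLeft ℂ ρ)).integral_comp_comm hψ).symm

/-- The left variance `E_ν(ψ*ψ) - E_ν(ψ*) E_ν(ψ)`. -/
def QuantumProbMeasure.leftVariance (ν : QuantumProbMeasure X H) (ψ : X → H →L[ℂ] H) :
    H →L[ℂ] H :=
  ν.expectation (fun x => star (ψ x) * ψ x) -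
    ν.expectation (fun x => star (ψ x)) * ν.expectation ψ

/-- The right variance `E_ν(ψψ*) - E_ν(ψ) E_ν(ψ*)`. -/
def QuantumProbMeasure.rightVariance (ν : QuantumProbMeasure X H) (ψ : X → H →L[ℂ] H) :
    H →L[ℂ] H :=
  ν.expectation (fun x => ψ x * star (ψ x)) -
    ν.expectation ψ * ν.expectation (fun x => star (ψ x))

/-- The quantum variance: the average of the left and the right variance. -/
def QuantumProbMeasure.variance (ν : QuantumProbMeasure X H) (ψ : X → H →L[ℂ] H) :
    H →L[ℂ] H :=
  (1 / 2 : ℂ) • (ν.leftVariance ψ + ν.rightVariance ψ)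

/-- The random quantum noise `N(ν)`: the supremum, taken in `[0, ∞]`, of `‖Var_ν(ψ)‖` over the
closed unit ball of `L^∞_H(X, ν) = L^∞(X, μ; B(H))`. -/
def QuantumProbMeasure.randomNoise (ν : QuantumProbMeasure X H) : ℝ≥0∞ :=
  ⨆ ψ ∈ Metric.closedBall (0 : Lp (H →L[ℂ] H) ∞ ν.inducedMeasure) 1, ‖ν.variance ψ‖ₑ

end Noise

end

end QuantumNoise

namespace QuantumNoise

open InnerProductSpace ContinuousLinearMap
open scoped ComplexOrder

/-! Let D be the principal derivative. Since the variance of the indicator of E times 1 is ν(E) -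
ν(E)², zero noise makes each P = ν(E) idempotent. If P were neither 0 nor 1, there would be unit
vectors u in ker P and v in ran P = ker ν(Eᶜ). As ∫_E ‖D^{1/2}u‖² dμ = ⟨u, ν(E)u⟩ = 0, and similarly
for v on Eᶜ, the constant function ψ = |u⟩⟨v| has expectation 0. Its variance is then half the
expectation of |v⟩⟨v| + |u⟩⟨u|, and expectation preserves the trace of constants, so the variance
has trace 1, a contradiction. Hence ν takes only the values 0 and 1 (`eq_zero_or_eq_one`).

Compactness gives a point x₀ with no null open neighbourhood; all its open neighbourhoods have value
1, and outer regularity gives ν({x₀}) = 1.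

Conversely, for ν = δ_{x₀}1 the expectation is evaluation at x₀, which is multiplicative, so every
variance vanishes. -/

/-- Positivity of an operator may be tested on a dense set of vectors. -/
theorem nonneg_of_dense {H : Type*} [NormedAddCommGroup H] [InnerProductSpace ℂ H]
    {A : H →L[ℂ] H} {s : Set H}
    (hs : Dense s)
    (h : ∀ v ∈ s, 0 ≤ inner ℂ v (A v)) : 0 ≤ A := by
  have hc : IsClosed {v : H | 0 ≤ inner ℂ v (A v)} :=
    isClosed_le continuous_const (by fun_prop)
  have hall : ∀ v, 0 ≤ inner ℂ v (A v) := fun v =>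
    (hc.closure_subset_iff.2 h) (hs.closure_eq ▸ Set.mem_univ v)
  rw [nonneg_iff_isPositive, isPositive_iff_complex]
  intro v
  have hv : 0 ≤ inner ℂ (A v) v := by
    rw [← inner_conj_symm]
    exact star_nonneg_iff.2 (hall v)
  exact ⟨Complex.ext (by simp) (by simpa using (Complex.le_def.1 hv).2), (Complex.le_def.1 hv).1⟩

/-! ### Trace duality on `B(H)` -/

section Trace

variable {H : Type*} [NormedAddCommGroup H] [InnerProductSpace ℂ H] [CompleteSpace H]
  [FiniteDimensional ℂ H]

theorem tr_rankOne_mul (u v : H) (A : H →L[ℂ] H) : tr (rankOne ℂ u v * A) = inner ℂ v (A u) := by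
  rw [ContinuousLinearMap.mul_def, rankOne_comp, ← adjoint_inner_left]
  exact trace_rankOne _ _

/-- Every operator is a linear combination of density operators. -/
theorem span_isDensityOperator :
    Submodule.span ℂ {ρ : H →L[ℂ] H | IsDensityOperator ρ} = ⊤ := by
  rw [eq_top_iff, ← CStarAlgebra.span_nonneg, Submodule.span_le]
  intro T (hT : 0 ≤ T)
  by_cases h0 : (tr T).re = 0
  · rw [eq_zero_of_tr_re_eq_zero hT h0]
    exact Submodule.zero_mem _
  have him : tr T = ((tr T).re : ℂ) := by
    have h := ((nonneg_iff_isPositive T).1 hT).toLinearMap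
    exact Complex.ext rfl (Complex.le_def.1 h.trace_nonneg).2.symm
  have h1 : T = tr T • ((tr T).re⁻¹ • T) := by
    rw [him, Complex.ofReal_re]
    ext x
    simp [h0]
  have h2 : IsDensityOperator ((tr T).re⁻¹ • T) := by
    refine ⟨smul_nonneg (inv_nonneg.2 (tr_re_nonneg hT)) hT, ?_⟩
    rw [show tr ((tr T).re⁻¹ • T) = ((tr T).re⁻¹ : ℝ) • tr T from
      ((tr (H := H)).restrictScalars ℝ).map_smul _ _]
    conv_lhs => rw [him]
    simp [h0]
  rw [h1]
  exact Submodule.smul_mem _ _ (Submodule.subset_span h2)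

theorem eq_of_forall_tr_mul_eq {A B : H →L[ℂ] H} (h : ∀ T, tr (T * A) = tr (T * B)) : A = B := by
  ext u
  refine ext_inner_left ℂ fun v => ?_
  rw [← tr_rankOne_mul, ← tr_rankOne_mul, h]

end Trace

/-! ### Integration of operator-valued functions -/

section OperatorValued

variable {X : Type*} [MeasurableSpace X] {μ : Measure X}
  {H : Type*} [NormedAddCommGroup H] [InnerProductSpace ℂ H] [CompleteSpace H]
  [FiniteDimensional ℂ H]

theorem integrable_of_forall_tr_mul {f : X → H →L[ℂ] H}
    (hf : ∀ T, Integrable (fun x => tr (T * f x)) μ) : Integrable f μ := by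
  let b := stdOrthonormalBasis ℂ H
  -- Expansion in matrix units; the coefficients are the entries ⟨b i, f(x) b j⟩.
  have h : f = fun x => ∑ j, ∑ i, tr (rankOne ℂ (b j) (b i) * f x) • rankOne ℂ (b i) (b j) := by
    funext x
    refine ContinuousLinearMap.coe_injective (b.toBasis.ext fun k => ?_)
    simp [tr_rankOne_mul, b.inner_eq_ite, b.sum_repr']
  rw [h]
  exact integrable_finsetSum _ fun j _ => integrable_finsetSum _ fun i _ => (hf _).smul_const _

theorem integral_tr_mul {f : X → H →L[ℂ] H} (hf : Integrable f μ) (T : H →L[ℂ] H) :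
    ∫ x, tr (T * f x) ∂μ = tr (T * ∫ x, f x ∂μ) :=
  (LinearMap.toContinuousLinearMap (tr ∘ₗ LinearMap.mulLeft ℂ T)).integral_comp_comm hf

theorem integral_inner_apply {f : X → H →L[ℂ] H} (hf : Integrable f μ) (u v : H) :
    ∫ x, inner ℂ v (f x u) ∂μ = inner ℂ v ((∫ x, f x ∂μ) u) := by
  simp_rw [← tr_rankOne_mul]
  exact integral_tr_mul hf _

/-- An integrable operator-valued function all of whose set integrals are positive is positive
almost everywhere. -/
theorem ae_nonneg_of_forall_setIntegral_nonneg {f : X → H →L[ℂ] H} (hf : Integrable f μ)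
    (h : ∀ E, MeasurableSet E → 0 ≤ ∫ x in E, f x ∂μ) : ∀ᵐ x ∂μ, 0 ≤ f x := by
  have hpt : ∀ v : H, ∀ᵐ x ∂μ, 0 ≤ inner ℂ v (f x v) := by
    intro v
    have hi := ((ContinuousLinearMap.apply ℂ H v).integrable_comp hf).const_inner (𝕜 := ℂ) v
    have hE : ∀ E, MeasurableSet E → 0 ≤ ∫ x in E, inner ℂ v (f x v) ∂μ := fun E hE => by
      rw [integral_inner_apply hf.integrableOn]
      exact ((nonneg_iff_isPositive _).1 (h E hE)).inner_nonneg_right v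
    have hre := MeasureTheory.ae_nonneg_of_forall_setIntegral_nonneg hi.re fun E hE' _ => by
      rw [integral_re hi.integrableOn]
      exact (Complex.le_def.1 (hE E hE')).1
    have him := hi.im.ae_eq_zero_of_forall_setIntegral_eq_zero fun E hE' _ => by
      rw [integral_im hi.integrableOn]
      exact (Complex.le_def.1 (hE E hE')).2.symm
    filter_upwards [hre, him] with x h1 h2
    exact Complex.le_def.2 ⟨h1, (show (inner ℂ v (f x v)).im = 0 from h2).symm⟩
  -- The null set in `hpt` depends on v; countably many v suffice, by density.
  have hd := TopologicalSpace.exists_countable_dense H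
  obtain ⟨s, hsc, hsd⟩ := hd
  filter_upwards [(ae_ball_iff hsc).2 fun v _ => hpt v] with x hx
  exact nonneg_of_dense hsd hx

end OperatorValued

/-! ### The Radon–Nikodym identity as an operator identity -/

section RNDeriv

variable {X : Type*} [MeasurableSpace X] {H : Type*} [NormedAddCommGroup H]
  [InnerProductSpace ℂ H] [CompleteSpace H] [FiniteDimensional ℂ H]
  (ν : QuantumProbMeasure X H)

namespace QuantumProbMeasure

/-- Both sides of the defining identity are linear in T, and density operators span `B(H)`. -/
theorem tr_mul_rnDeriv (T : H →L[ℂ] H) :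
    Integrable (fun x => tr (T * ν.rnDeriv x)) ν.inducedMeasure ∧ ∀ E, MeasurableSet E →
      ∫ x in E, tr (T * ν.rnDeriv x) ∂ν.inducedMeasure = tr (T * ν.toVectorMeasure E) := by
  have hT : T ∈ Submodule.span ℂ {ρ : H →L[ℂ] H | IsDensityOperator ρ} := by
    rw [span_isDensityOperator]; trivial
  induction hT using Submodule.span_induction with
  | mem ρ hρ => exact ν.exists_isPrincipalRNDeriv.choose_spec.2 ρ hρ
  | zero => simp
  | add S T _ _ hS hT =>
    simp only [add_mul, map_add]
    refine ⟨hS.1.add hT.1, fun E hE => ?_⟩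
    rw [integral_add hS.1.integrableOn hT.1.integrableOn, hS.2 E hE, hT.2 E hE]
  | smul c T _ hT =>
    simp only [smul_mul_assoc, map_smul]
    refine ⟨hT.1.smul c, fun E hE => ?_⟩
    rw [integral_smul, hT.2 E hE]

theorem integrable_rnDeriv : Integrable ν.rnDeriv ν.inducedMeasure :=
  integrable_of_forall_tr_mul fun T => (ν.tr_mul_rnDeriv T).1

theorem setIntegral_rnDeriv {E : Set X} (hE : MeasurableSet E) :
    ∫ x in E, ν.rnDeriv x ∂ν.inducedMeasure = ν.toVectorMeasure E :=
  eq_of_forall_tr_mul_eq fun T => by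
    rw [← integral_tr_mul ν.integrable_rnDeriv.integrableOn, (ν.tr_mul_rnDeriv T).2 E hE]

theorem ae_rnDeriv_nonneg : ∀ᵐ x ∂ν.inducedMeasure, 0 ≤ ν.rnDeriv x :=
  ae_nonneg_of_forall_setIntegral_nonneg ν.integrable_rnDeriv fun E hE => by
    rw [ν.setIntegral_rnDeriv hE]
    exact ν.nonneg' E hE

end QuantumProbMeasure

end RNDeriv

/-! ### The operator square root -/

section Sqrt

variable {H : Type*} [NormedAddCommGroup H] [InnerProductSpace ℂ H] [CompleteSpace H]

theorem continuousOn_sqrt :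
    ContinuousOn (CFC.sqrt : (H →L[ℂ] H) → H →L[ℂ] H) {A | 0 ≤ A} :=
  continuousOn_id.cfcₙ_nnreal_of_mem_nhdsSet (s := Set.univ) NNReal.sqrt
    (fun _ _ => Filter.univ_mem) (fun _ hA => hA) NNReal.continuous_sqrt.continuousOn NNReal.sqrt_zero

theorem measurable_sqrt : Measurable (CFC.sqrt : (H →L[ℂ] H) → H →L[ℂ] H) := by
  classical
  have hm : MeasurableSet {A : H →L[ℂ] H | 0 ≤ A} := CStarAlgebra.isClosed_nonneg.measurableSet
  have h := continuousOn_sqrt.measurable_piecewise (g := fun _ : H →L[ℂ] H => (0 : H →L[ℂ] H))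
    continuousOn_const hm
  convert h using 1
  funext A
  by_cases hA : 0 ≤ A
  · simp [Set.piecewise, hA]
  -- Off the positive cone `CFC.sqrt` takes the default value 0.
  · simpa [Set.piecewise, hA] using
      show CFC.sqrt A = 0 from cfcₙ_apply_of_not_predicate A hA

theorem adjoint_sqrt (A : H →L[ℂ] H) : adjoint (CFC.sqrt A) = CFC.sqrt A :=
  (IsSelfAdjoint.of_nonneg (CFC.sqrt_nonneg A)).star_eq

theorem norm_sqrt_mul_self {A : H →L[ℂ] H} (hA : 0 ≤ A) :
    ‖CFC.sqrt A‖ * ‖CFC.sqrt A‖ = ‖A‖ := by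
  rw [← CStarRing.norm_star_mul_self, (IsSelfAdjoint.of_nonneg (CFC.sqrt_nonneg A)).star_eq,
    CFC.sqrt_mul_sqrt_self A hA]

theorem norm_sqrt_apply_sq {A : H →L[ℂ] H} (hA : 0 ≤ A) (u : H) :
    ‖CFC.sqrt A u‖ ^ 2 = (inner ℂ u (A u)).re := by
  rw [@norm_sq_eq_re_inner ℂ, ← adjoint_inner_right, adjoint_sqrt, ← mul_apply_eq_comp,
    CFC.sqrt_mul_sqrt_self A hA]
  rfl

theorem sqrt_mul_rankOne_mul_sqrt (A : H →L[ℂ] H) (u v : H) :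
    CFC.sqrt A * rankOne ℂ u v * CFC.sqrt A = rankOne ℂ (CFC.sqrt A u) (CFC.sqrt A v) := by
  ext w
  simp only [mul_apply_eq_comp, rankOne_apply, map_smul]
  rw [← adjoint_inner_left, adjoint_sqrt]

end Sqrt

/-! ### Expectation, variance and the zero-one law -/

variable {X : Type*} [MeasurableSpace X] {H : Type*} [NormedAddCommGroup H]
  [InnerProductSpace ℂ H] [CompleteSpace H] [FiniteDimensional ℂ H]
  (ν : QuantumProbMeasure X H)

namespace QuantumProbMeasure

theorem expectation_congr {ψ φ : X → H →L[ℂ] H} (h : ψ =ᵐ[ν.inducedMeasure] φ) :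
    ν.expectation ψ = ν.expectation φ :=
  integral_congr_ae (h.mono fun x hx => by simp only [hx])

theorem variance_congr {ψ φ : X → H →L[ℂ] H} (h : ψ =ᵐ[ν.inducedMeasure] φ) :
    ν.variance ψ = ν.variance φ := by
  have hs : (fun x => star (ψ x)) =ᵐ[ν.inducedMeasure] fun x => star (φ x) := h.fun_comp star
  have hl := ν.expectation_congr (hs.mul h)
  have hr := ν.expectation_congr (h.mul hs)
  simp only [Pi.mul_def] at hl hr
  simp only [variance, leftVariance, rightVariance, ν.expectation_congr h,
    ν.expectation_congr hs, hl, hr]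

theorem integrable_sqrt_mul_mul_sqrt (T : H →L[ℂ] H) :
    Integrable (fun x => CFC.sqrt (ν.rnDeriv x) * T * CFC.sqrt (ν.rnDeriv x))
      ν.inducedMeasure := by
  have hm : AEStronglyMeasurable (fun x => CFC.sqrt (ν.rnDeriv x)) ν.inducedMeasure :=
    (measurable_sqrt.comp_aemeasurable
      ν.integrable_rnDeriv.aestronglyMeasurable.aemeasurable).aestronglyMeasurable
  refine (ν.integrable_rnDeriv.norm.mul_const ‖T‖).mono'
    ((hm.mul aestronglyMeasurable_const).mul hm) ?_
  filter_upwards [ν.ae_rnDeriv_nonneg] with x hx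
  calc ‖CFC.sqrt (ν.rnDeriv x) * T * CFC.sqrt (ν.rnDeriv x)‖
      ≤ ‖CFC.sqrt (ν.rnDeriv x)‖ * ‖T‖ * ‖CFC.sqrt (ν.rnDeriv x)‖ := norm_mul₃_le
    _ = ‖ν.rnDeriv x‖ * ‖T‖ := by rw [← norm_sqrt_mul_self hx]; ring

/-- The quantum expectation preserves the trace of constants. -/
theorem tr_expectation_const (T : H →L[ℂ] H) : tr (ν.expectation fun _ => T) = tr T := by
  have h := ν.tr_mul_expectation (ν.integrable_sqrt_mul_mul_sqrt T) 1
  rw [one_mul] at h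
  rw [h]
  -- Cyclicity of the trace brings the two square roots together.
  have hae : (fun x => tr (1 * (CFC.sqrt (ν.rnDeriv x) * T * CFC.sqrt (ν.rnDeriv x))))
      =ᵐ[ν.inducedMeasure] fun x => tr (T * ν.rnDeriv x) := by
    filter_upwards [ν.ae_rnDeriv_nonneg] with x hx
    rw [one_mul, mul_assoc]
    refine (LinearMap.trace_mul_comm ℂ _ _).trans ?_
    conv_rhs => rw [← CFC.sqrt_mul_sqrt_self (ν.rnDeriv x) hx]
    rfl
  rw [integral_congr_ae hae, ← setIntegral_univ, (ν.tr_mul_rnDeriv T).2 _ MeasurableSet.univ,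
    ν.univ_eq_one', mul_one]

theorem expectation_indicator_one {E : Set X} (hE : MeasurableSet E) :
    ν.expectation (E.indicator fun _ => 1) = ν.toVectorMeasure E := by
  rw [← ν.setIntegral_rnDeriv hE, ← integral_indicator hE]
  refine integral_congr_ae ?_
  filter_upwards [ν.ae_rnDeriv_nonneg] with x hx
  by_cases hxE : x ∈ E
  · simp [hxE, CFC.sqrt_mul_sqrt_self _ hx]
  · simp [hxE]

theorem variance_indicator_one {E : Set X} (hE : MeasurableSet E) :
    ν.variance (E.indicator fun _ => 1) =
      ν.toVectorMeasure E - ν.toVectorMeasure E * ν.toVectorMeasure E := by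
  have h1 : (fun x => star (E.indicator (fun _ => (1 : H →L[ℂ] H)) x)) =
      E.indicator fun _ => 1 := by
    funext x; by_cases hx : x ∈ E <;> simp [hx]
  have h2 : (fun x => E.indicator (fun _ => (1 : H →L[ℂ] H)) x *
      E.indicator (fun _ => (1 : H →L[ℂ] H)) x) = E.indicator fun _ => 1 := by
    funext x; by_cases hx : x ∈ E <;> simp [hx]
  have h1' : ∀ x, star (E.indicator (fun _ => (1 : H →L[ℂ] H)) x) =
      E.indicator (fun _ => 1) x := congrFun h1
  simp only [variance, leftVariance, rightVariance, h1', h2, ν.expectation_indicator_one hE]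
  rw [← two_smul ℂ, smul_smul]
  norm_num

theorem ae_sqrt_rnDeriv_apply_eq_zero {E : Set X} (hE : MeasurableSet E) {u : H}
    (hu : ν.toVectorMeasure E u = 0) :
    ∀ᵐ x ∂ν.inducedMeasure, x ∈ E → CFC.sqrt (ν.rnDeriv x) u = 0 := by
  have hi : Integrable (fun x => inner ℂ u (ν.rnDeriv x u)) ν.inducedMeasure :=
    ((ContinuousLinearMap.apply ℂ H u).integrable_comp ν.integrable_rnDeriv).const_inner u
  have hnn : ∀ᵐ x ∂ν.inducedMeasure, 0 ≤ (inner ℂ u (ν.rnDeriv x u)).re := by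
    filter_upwards [ν.ae_rnDeriv_nonneg] with x hx
    rw [← norm_sqrt_apply_sq hx]
    positivity
  have h0 : ∫ x in E, (inner ℂ u (ν.rnDeriv x u)).re ∂ν.inducedMeasure = 0 := by
    refine (integral_re hi.integrableOn).trans ?_
    rw [integral_inner_apply ν.integrable_rnDeriv.integrableOn, ν.setIntegral_rnDeriv hE, hu]
    simp
  rw [setIntegral_eq_zero_iff_of_nonneg_ae (ae_restrict_of_ae hnn) hi.re.integrableOn] at h0
  filter_upwards [(ae_restrict_iff' hE).1 h0, ν.ae_rnDeriv_nonneg] with x hx hx0 hxE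
  have := norm_sqrt_apply_sq hx0 u
  rw [show (inner ℂ u (ν.rnDeriv x u)).re = 0 from hx hxE] at this
  simpa using this

/-- The integrand is |D^{1/2}u⟩⟨D^{1/2}v|: its first factor vanishes a.e. on E, its second a.e. on
Eᶜ. -/
theorem expectation_rankOne_eq_zero {E : Set X} (hE : MeasurableSet E) {u v : H}
    (hu : ν.toVectorMeasure E u = 0) (hv : ν.toVectorMeasure Eᶜ v = 0) :
    ν.expectation (fun _ => rankOne ℂ u v) = 0 := by
  refine integral_eq_zero_of_ae ?_
  filter_upwards [ν.ae_sqrt_rnDeriv_apply_eq_zero hE hu,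
    ν.ae_sqrt_rnDeriv_apply_eq_zero hE.compl hv] with x hx hx'
  rw [sqrt_mul_rankOne_mul_sqrt]
  by_cases hxE : x ∈ E
  · simp [hx hxE]
  · simp [hx' hxE]

theorem variance_rankOne_ne_zero {E : Set X} (hE : MeasurableSet E) {u v : H}
    (hu : ν.toVectorMeasure E u = 0) (hv : ν.toVectorMeasure Eᶜ v = 0)
    (hu1 : ‖u‖ = 1) (hv1 : ‖v‖ = 1) : ν.variance (fun _ => rankOne ℂ u v) ≠ 0 := by
  intro h
  have hl : star (rankOne ℂ u v) * rankOne ℂ u v = rankOne ℂ v v := by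
    rw [ContinuousLinearMap.star_eq_adjoint, adjoint_rankOne, ContinuousLinearMap.mul_def,
      rankOne_comp_rankOne]
    simp [hu1]
  have hr : rankOne ℂ u v * star (rankOne ℂ u v) = rankOne ℂ u u := by
    rw [ContinuousLinearMap.star_eq_adjoint, adjoint_rankOne, ContinuousLinearMap.mul_def,
      rankOne_comp_rankOne]
    simp [hv1]
  have ht : ∀ w : H, ‖w‖ = 1 → tr (rankOne ℂ w w) = 1 := fun w hw => by
    rw [← mul_one (rankOne ℂ w w), tr_rankOne_mul]
    simp [hw]
  rw [variance, leftVariance, rightVariance, ν.expectation_rankOne_eq_zero hE hu hv] at h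
  simp only [hl, hr, mul_zero, zero_mul, sub_zero] at h
  have := congrArg tr h
  rw [map_smul, map_add, ν.tr_expectation_const, ν.tr_expectation_const, ht u hu1, ht v hv1,
    map_zero] at this
  norm_num at this

theorem variance_indicator_eq_zero (h : ν.randomNoise = 0) {E : Set X} (hE : MeasurableSet E)
    {T : H →L[ℂ] H} (hT : ‖T‖ ≤ 1) : ν.variance (E.indicator fun _ => T) = 0 := by
  let ψ := indicatorConstLp ⊤ hE (measure_ne_top ν.inducedMeasure E) T
  have hψ : ψ ∈ Metric.closedBall (0 : Lp (H →L[ℂ] H) ⊤ ν.inducedMeasure) 1 := by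
    rw [mem_closedBall_zero_iff]
    refine norm_indicatorConstLp_le.trans ?_
    simpa using hT
  have h0 := (iSup₂_eq_bot.1 h) ψ hψ
  -- The noise sees a chosen representative of the L^∞ class, equal to the indicator only a.e.
  rw [← ν.variance_congr indicatorConstLp_coeFn]
  simpa using h0

/-- If the random quantum noise vanishes, then `ν` takes only the values `0` and `1`. -/
theorem eq_zero_or_eq_one (h : ν.randomNoise = 0) {E : Set X} (hE : MeasurableSet E) :
    ν.toVectorMeasure E = 0 ∨ ν.toVectorMeasure E = 1 := by
  set P := ν.toVectorMeasure E with hP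
  have hidem : P * P = P := by
    have := ν.variance_indicator_eq_zero h hE (T := 1) norm_id_le
    rw [ν.variance_indicator_one hE] at this
    exact (sub_eq_zero.1 this).symm
  have hc : ν.toVectorMeasure Eᶜ = 1 - P := by
    rw [hP, VectorMeasure.of_compl hE, ν.univ_eq_one']
  by_contra! hne
  obtain ⟨a, ha⟩ : ∃ a, P a ≠ 0 := by
    by_contra! h0
    exact hne.1 (ContinuousLinearMap.ext h0)
  obtain ⟨b, hb⟩ : ∃ b, (1 - P) b ≠ 0 := by
    by_contra! h0
    exact hne.2 (sub_eq_zero.1 (ContinuousLinearMap.ext h0)).symm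
  -- As P is idempotent, P kills the range of 1 - P, and 1 - P = ν(Eᶜ) kills the range of P.
  refine ν.variance_rankOne_ne_zero hE (u := (‖(1 - P) b‖⁻¹ : ℂ) • (1 - P) b)
    (v := (‖P a‖⁻¹ : ℂ) • P a) ?_ ?_ ?_ ?_ ?_
  · rw [← hP, map_smul, ← mul_apply_eq_comp, mul_sub, mul_one, hidem]
    simp
  · rw [hc, map_smul, ← mul_apply_eq_comp, sub_mul, one_mul, hidem]
    simp
  · exact norm_smul_inv_norm hb
  · exact norm_smul_inv_norm ha
  · rw [← Set.indicator_univ (fun _ : X => rankOne ℂ _ _)]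
    refine ν.variance_indicator_eq_zero h MeasurableSet.univ ?_
    rw [norm_rankOne]
    exact (congrArg₂ (· * ·) (norm_smul_inv_norm hb) (norm_smul_inv_norm ha)).trans (one_mul 1) |>.le

/-- Transfers monotonicity and subadditivity of null sets from μ to ν. -/
theorem inducedMeasure_eq_zero_iff {E : Set X} (hE : MeasurableSet E) :
    ν.inducedMeasure E = 0 ↔ ν.toVectorMeasure E = 0 := by
  constructor <;> intro h
  · rw [← ν.setIntegral_rnDeriv hE, Measure.restrict_zero_set h, integral_zero_measure]
  · rw [← measureReal_eq_zero_iff, ν.inducedMeasure_real_apply hE, h]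
    simp

theorem apply_eq_zero_of_subset {E F : Set X} (hEF : E ⊆ F) (hE : MeasurableSet E)
    (hF : MeasurableSet F) (h : ν.toVectorMeasure F = 0) : ν.toVectorMeasure E = 0 :=
  (ν.inducedMeasure_eq_zero_iff hE).1
    (measure_mono_null hEF ((ν.inducedMeasure_eq_zero_iff hF).2 h))

/-! ### Locating the atom by compactness and regularity -/

section Topology

variable [TopologicalSpace X]

theorem exists_forall_isOpen_ne_zero [CompactSpace X] [OpensMeasurableSpace X] :
    ∃ x₀, ∀ U : Set X, IsOpen U → x₀ ∈ U → ν.toVectorMeasure U ≠ 0 := by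
  by_contra! hU
  choose U hUo hUx hU0 using hU
  obtain ⟨t, ht⟩ := isCompact_univ.elim_finite_subcover U hUo
    fun x _ => Set.mem_iUnion.2 ⟨x, hUx x⟩
  refine ν.toPOVM.univ_ne_zero' ((ν.inducedMeasure_eq_zero_iff MeasurableSet.univ).1 ?_)
  refine measure_mono_null ht ((measure_biUnion_null_iff t.countable_toSet).2 fun x _ => ?_)
  exact (ν.inducedMeasure_eq_zero_iff (hUo x).measurableSet).2 (hU0 x)

theorem eq_dirac_of_randomNoise_eq_zero [CompactSpace X] [T2Space X] [OpensMeasurableSpace X]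
    (hν : ν.IsRegular) (h : ν.randomNoise = 0) :
    ∃ x₀ : X, ν.toVectorMeasure = VectorMeasure.dirac x₀ (1 : H →L[ℂ] H) := by
  obtain ⟨x₀, hx₀⟩ := ν.exists_forall_isOpen_ne_zero
  -- Regularity concerns Borel sets, while the ambient σ-algebra may be larger.
  have hm : MeasurableSet[borel X] {x₀} :=
    @IsClosed.measurableSet X {x₀} _ (borel X) (@OpensMeasurableSpace.mk X _ (borel X) le_rfl)
      isClosed_singleton
  have hs : ν.toVectorMeasure {x₀} = 1 := by
    have hglb := (hν {x₀} hm).1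
    refine hglb.unique ?_
    -- Every open neighbourhood of x₀ has value 1, so the infimum is over the singleton {1}.
    convert isGLB_singleton (a := (1 : H →L[ℂ] H)) using 1
    ext T
    constructor
    · rintro ⟨U, hU, hxU, rfl⟩
      exact (ν.eq_zero_or_eq_one h hU.measurableSet).resolve_left
        (hx₀ U hU (Set.singleton_subset_iff.1 hxU))
    · rintro rfl
      exact ⟨Set.univ, isOpen_univ, Set.subset_univ _, ν.univ_eq_one'⟩
  have hcompl : ν.toVectorMeasure {x₀}ᶜ = 0 := by
    rw [VectorMeasure.of_compl isClosed_singleton.measurableSet, hs, ν.univ_eq_one', sub_self]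
  have hoff : ∀ E, MeasurableSet E → x₀ ∉ E → ν.toVectorMeasure E = 0 := fun E hE hx =>
    ν.apply_eq_zero_of_subset (Set.subset_compl_singleton_iff.2 hx) hE
      (isClosed_singleton (x := x₀)).measurableSet.compl hcompl
  refine ⟨x₀, VectorMeasure.ext fun E hE => ?_⟩
  by_cases hx : x₀ ∈ E
  · have := VectorMeasure.of_compl (v := ν.toVectorMeasure) hE
    rw [hoff _ hE.compl (Set.notMem_compl_iff.2 hx), ν.univ_eq_one'] at this
    rw [VectorMeasure.dirac_apply_of_mem hE hx, sub_eq_zero.1 this.symm]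
  · rw [hoff E hE hx, VectorMeasure.dirac_apply_of_notMem hx]

end Topology

/-! ### The converse: Dirac measures have no noise -/

theorem inducedMeasure_eq_dirac {x₀ : X}
    (h : ν.toVectorMeasure = VectorMeasure.dirac x₀ (1 : H →L[ℂ] H)) :
    ν.inducedMeasure = Measure.dirac x₀ := by
  have : Nontrivial H := not_subsingleton_iff_nontrivial.1 fun _ =>
    ν.univ_ne_zero' (Subsingleton.elim _ _)
  have htr : tr (1 : H →L[ℂ] H) = (Module.finrank ℂ H : ℂ) := LinearMap.trace_one ℂ H
  have hd : (Module.finrank ℂ H : ℝ) ≠ 0 := Nat.cast_ne_zero.2 Module.finrank_pos.ne'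
  ext E hE
  rw [← measureReal_eq_measureReal_iff, ν.inducedMeasure_real_apply hE, h]
  by_cases hx : x₀ ∈ E
  · simp [Measure.real, hE, hx, htr, hd]
  · simp [Measure.real, hE, hx]

theorem randomNoise_eq_zero_of_eq_dirac [MeasurableSingletonClass X] {x₀ : X}
    (h : ν.toVectorMeasure = VectorMeasure.dirac x₀ (1 : H →L[ℂ] H)) : ν.randomNoise = 0 := by
  have hμ := ν.inducedMeasure_eq_dirac h
  have hD : ν.rnDeriv x₀ = 1 := by
    have := ν.setIntegral_rnDeriv (MeasurableSet.univ)
    rwa [setIntegral_univ, hμ, integral_dirac, ν.univ_eq_one'] at this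
  -- Since singletons are measurable, `integral_dirac` applies to every ψ, measurable or not.
  have hexp : ∀ ψ : X → H →L[ℂ] H, ν.expectation ψ = ψ x₀ := fun ψ => by
    rw [expectation, hμ, integral_dirac, hD, CFC.sqrt_one, one_mul, mul_one]
  simp [randomNoise, variance, leftVariance, rightVariance, hexp]

end QuantumProbMeasure

end QuantumNoise

theorem mainTheorem8 {X : Type*} [TopologicalSpace X] [CompactSpace X] [T2Space X]
    [MeasurableSpace X] [OpensMeasurableSpace X]
    {H : Type*} [NormedAddCommGroup H] [InnerProductSpace ℂ H] [CompleteSpace H]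
    [FiniteDimensional ℂ H]
    (ν : QuantumNoise.QuantumProbMeasure X H) (hν : ν.IsRegular) :
    ν.randomNoise = 0 ↔
      ∃ x₀ : X, ν.toVectorMeasure = VectorMeasure.dirac x₀ (1 : H →L[ℂ] H) :=
  ⟨ν.eq_dirac_of_randomNoise_eq_zero hν, fun ⟨_, h⟩ => ν.randomNoise_eq_zero_of_eq_dirac h⟩
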